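/- Let $p$ be a prime. For a group $G$, let $\Gamma_p(G)$ be the graph whose vertices are the finite-index subgroups of $G$, two distinct vertices $A$, $B$ being adjacent if and only if $[A : A\cap B]\,[B : A\cap B]$ is a power of $p$. Let $F$ be a free group of rank two. Then for every $N > 0$ there are infinitely many geodesics $\gamma$ in $\Gamma_p(F)$ (finite paths whose length is the graph distance between their endpoints), lying in pairwise different connected components of $\Gamma_p(F)$, such that the length of each $\gamma$ is greater than $N$. -/

import Mathlib

/-- The `p`-local commensurability graph of a group `G`: the vertices are the finite-index subgroups
of `G`, and two distinct vertices `A`, `B` are adjacent iff `[A : A ∩ B] [B : A ∩ B]` is a power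
of `p` (possibly `p ^ 0 = 1`, but that only happens for `A = B`). -/
def localCommGraph (p : ℕ) (G : Type*) [Group G] :
    SimpleGraph {H : Subgroup G // H.FiniteIndex} where
  Adj A B := A ≠ B ∧ ∃ k : ℕ,
    (A.1 ⊓ B.1).relIndex A.1 * (A.1 ⊓ B.1).relIndex B.1 = p ^ k
  symm := ⟨by
    rintro A B ⟨hne, k, hk⟩
    exact ⟨hne.symm, k, by rw [inf_comm, mul_comm]; exact hk⟩⟩
  loopless := ⟨fun _ h => h.1 rfl⟩

/-- A walk in a graph is a geodesic if its length is the distance between its endpoints, that is,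
if no walk between these endpoints is shorter. -/
def SimpleGraph.Walk.IsGeodesic {V : Type*} {Γ : SimpleGraph V} {u v : V} (w : Γ.Walk u v) :
    Prop :=
  w.length = Γ.dist u v

/-!
The free group `F` acts on the set `V` of functions `K → ZMod r`, where `K` is a finite field with
`p ^ d` elements and `r > 1` is prime to `p * |Kˣ|`, through a homomorphism onto the group
`affineWreath K (ZMod r)` of all maps that combine an affine substitution in the argument with the
addition of a function. This group has two generators (`affineWreath_le_of_generators`). The
geodesics join the stabilizer of `0` to the stabilizer of an indicator function.

The endpoints are connected: if `v` and `v'` differ at a single point, then each of their stabilizers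
moves the other function through an orbit of length `|K| = p ^ d`, so the stabilizers are equal or
adjacent (`relIndex_functionStabilizer_add_single`).

They are far apart: all subgroups `H` in the component of the stabilizer of `0` have two properties,
each of which passes along edges. The multipliers of the elements of `H` exhaust `Kˣ`, because
`|Kˣ|` is prime to `p` (`map_eq_top_of_relIndex_eq_pow`), and `H` fixes a function, found by averaging an
orbit of `p`-power length (`exists_le_functionStabilizer`). If `H` and `H'` are adjacent, then
`H ⊓ H'` contains an element whose affine map permutes all points of `K` but one cyclically, so functions
fixed by `H` and by `H'` differ by a constant off one point (`exists_sub_eq_const`). So after `n` steps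
the fixed functions are constant off `n` points (`exists_fixed_of_walk`), whereas an indicator function of a
set that is large and has a large complement is not.

The index in `F` of the stabilizer of `0` is `r ^ |K|`, which is prime to `p`, and the prime-to-`p` part of
the index is constant on components (`index_eq_of_reachable`); so different values of `r` give
different components.
-/

/-! ### A wreath product of an abelian group with an affine group -/

section AffineWreath

open Equiv (Perm)

variable {K R : Type*}

/-- The action of `Perm K` on functions `K → R`: `e` sends `f` to `f ∘ e⁻¹`. -/
def permuteArguments (K R : Type*) : Perm K →* Perm (K → R) where
  toFun e := e.arrowCongr (Equiv.refl R)
  map_one' := rfl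
  map_mul' _ _ := rfl

theorem permuteArguments_apply (e : Perm K) (f : K → R) (y : K) :
    permuteArguments K R e f (e y) = f y := by
  exact congrArg f (e.symm_apply_apply y)

theorem permuteArguments_single [DecidableEq K] [Zero R] (e : Perm K) (w : K) (z : R) :
    permuteArguments K R e (Pi.single w z) = Pi.single (e w) z := by
  ext y
  obtain ⟨y, rfl⟩ := e.surjective y
  rw [permuteArguments_apply]
  simp [Pi.single_apply]

/-- The action of the additive group of functions `K → R` on itself by translations. -/
def translateBy (K R : Type*) [AddGroup R] : Multiplicative (K → R) →* Perm (K → R) where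
  toFun c := Equiv.addLeft c.toAdd
  map_one' := by ext; simp
  map_mul' _ _ := by ext; simp

theorem translateBy_apply [AddGroup R] (c f : K → R) :
    translateBy K R (.ofAdd c) f = c + f := rfl

theorem permuteArguments_mul_translateBy [AddGroup R] (e : Perm K) (c : K → R) :
    permuteArguments K R e * translateBy K R (.ofAdd c) =
      translateBy K R (.ofAdd (permuteArguments K R e c)) * permuteArguments K R e := by
  ext f y
  obtain ⟨y, rfl⟩ := e.surjective y
  simp [translateBy_apply, permuteArguments_apply]

variable [Field K]

/-- The wreath product of `R` with the affine group of the field `K`, acting on the functions `K → R`: it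
consists of the maps that move the arguments of a function by an affine bijection `y ↦ u * y + t` of
`K` and add a fixed function. The multiplier `u` is recorded as a first coordinate, so that it is a
homomorphism by construction. The condition determines the value of `π f` everywhere, since every
element of `K` has the form `u * y + t`. -/
def affineWreath (K R : Type*) [Field K] [AddCommGroup R] : Subgroup (Kˣ × Perm (K → R)) where
  carrier := {g | ∃ (t : K) (c : K → R), ∀ f y, g.2 f (g.1 * y + t) = f y + c y}
  one_mem' := ⟨0, 0, by simp⟩
  mul_mem' := by
    rintro ⟨u, π⟩ ⟨u', π'⟩ ⟨t, c, h⟩ ⟨t', c', h'⟩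
    refine ⟨u * t' + t, fun y => c' y + c (u' * y + t'), fun f y => ?_⟩
    have e : ((u * u' : Kˣ) : K) * y + (u * t' + t) = u * (u' * y + t') + t := by
      push_cast; ring
    simp only [Prod.mk_mul_mk, Perm.mul_apply] at h h' ⊢
    rw [e, h, h', add_assoc]
  inv_mem' := by
    rintro ⟨u, π⟩ ⟨t, c, h⟩
    refine ⟨-(u⁻¹ : Kˣ) * t, fun y => -c ((u⁻¹ : Kˣ) * y + -(u⁻¹ : Kˣ) * t), fun f y => ?_⟩
    have : π (π⁻¹ f) _ = π⁻¹ f _ + c _ := h (π⁻¹ f) ((u⁻¹ : Kˣ) * y + -(u⁻¹ : Kˣ) * t)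
    have e : (u : K) * ((u⁻¹ : Kˣ) * y + -(u⁻¹ : Kˣ) * t) + t = y := by
      simp [mul_add]
    rw [show π (π⁻¹ f) = f from π.apply_symm_apply f, e] at this
    simp only [Prod.inv_mk]
    rw [this]; abel

variable [AddCommGroup R]

/-- Every element is a function translation, then a dilation of `K`, then a translation of `K`. -/
theorem exists_eq_of_mem_affineWreath {u : Kˣ} {π : Perm (K → R)} (h : (u, π) ∈ affineWreath K R) :
    ∃ (t : K) (c : K → R), π = permuteArguments K R (Equiv.addRight t) *
      permuteArguments K R (Units.mulLeft u) * translateBy K R (.ofAdd c) := by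
  obtain ⟨t, c, h⟩ := h
  refine ⟨t, c, ?_⟩
  ext f z
  obtain ⟨y, rfl⟩ : ∃ y, (u : K) * y + t = z := ⟨(u⁻¹ : Kˣ) * (z - t), by simp⟩
  have h1 := permuteArguments_apply (Equiv.addRight t) (permuteArguments K R (Units.mulLeft u)
    (c + f)) (u * y)
  have h2 := permuteArguments_apply (Units.mulLeft u) (c + f) y
  simp only [Units.mulLeft_apply, Equiv.coe_addRight] at h1 h2
  simp only at h
  rw [h, Perm.mul_apply, Perm.mul_apply, translateBy_apply, h1, h2, Pi.add_apply, add_comm]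

theorem permute_addRight_mem_affineWreath (t : K) :
    ((1 : Kˣ), permuteArguments K R (Equiv.addRight t)) ∈ affineWreath K R := by
  refine ⟨t, 0, fun f y => ?_⟩
  simpa using permuteArguments_apply (Equiv.addRight t) f y

theorem permute_mulLeft_mem_affineWreath (u : Kˣ) :
    (u, permuteArguments K R (Units.mulLeft u)) ∈ affineWreath K R := by
  refine ⟨0, 0, fun f y => ?_⟩
  simpa using permuteArguments_apply (Units.mulLeft u) f y

theorem translateBy_mem_affineWreath (c : K → R) :
    ((1 : Kˣ), translateBy K R (.ofAdd c)) ∈ affineWreath K R :=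
  ⟨0, c, fun f y => by simp [translateBy_apply, add_comm]⟩

end AffineWreath

/-! ### Two generators -/

section Generators

open Equiv (Perm)

variable {K : Type*} [Field K] [Finite K] [DecidableEq K] {r : ℕ}

/-- Two elements generate `affineWreath K (ZMod r)`: the translation `y ↦ y + 1`, and the dilation by a
generator `a` of `Kˣ` multiplied by the translation `δ` by the point mass at `0`. The dilation fixes `0`, so
these two factors commute, and a power of their product is `δ ^ |Kˣ|`, which generates the same cyclic group as
`δ` because `r` is prime to `|Kˣ|`. So `δ` and the dilation are both available, and conjugation
gives everything else. -/
theorem affineWreath_le_of_generators {Γ : Subgroup (Kˣ × Perm (K → ZMod r))} {a : Kˣ}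
    (ha : ∀ u : Kˣ, u ∈ Subgroup.zpowers a) (hr : r.Coprime (Nat.card Kˣ))
    (h₁ : (1, permuteArguments K _ (Equiv.addRight 1)) ∈ Γ)
    (h₂ : (a, translateBy K _ (.ofAdd (Pi.single 0 1)) *
      permuteArguments K _ (Units.mulLeft a)) ∈ Γ) :
    affineWreath K (ZMod r) ≤ Γ := by
  set δ : Kˣ × Perm (K → ZMod r) := (1, translateBy K (ZMod r) (.ofAdd (Pi.single 0 1))) with hδ
  set D : Kˣ →* Kˣ × Perm (K → ZMod r) := (MonoidHom.id Kˣ).prod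
    ((permuteArguments K (ZMod r)).comp
      { toFun := Units.mulLeft
        map_one' := by ext; simp
        map_mul' := by intros; ext; simp [mul_assoc] })
  have hDa : ∀ u, D u = (u, permuteArguments K (ZMod r) (Units.mulLeft u)) := fun _ => rfl
  have hcomm : Commute δ (D a) := by
    simp only [Commute, SemiconjBy, hδ, hDa, Prod.mk_mul_mk, one_mul, mul_one]
    rw [permuteArguments_mul_translateBy, permuteArguments_single]
    simp
  have hδD : δ * D a ∈ Γ := by simpa [hδ, hDa] using h₂
  have hpow : δ ^ Nat.card Kˣ ∈ Γ := by
    have := Γ.pow_mem hδD (Nat.card Kˣ)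
    rwa [hcomm.mul_pow, ← map_pow, pow_card_eq_one', map_one, mul_one] at this
  have hδr : δ ^ r = 1 := by
    rw [hδ, Prod.pow_mk, ← map_pow, ← ofAdd_nsmul, one_pow]
    have : r • (Pi.single 0 1 : K → ZMod r) = 0 := by ext; simp
    rw [this]; simp
  have hδΓ : δ ∈ Γ := by
    have hgcd := Nat.gcd_eq_gcd_ab r (Nat.card Kˣ)
    rw [hr.gcd_eq_one] at hgcd
    have : δ = (δ ^ r) ^ (r.gcdA (Nat.card Kˣ)) * (δ ^ Nat.card Kˣ) ^ (r.gcdB (Nat.card Kˣ)) := by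
      rw [← zpow_natCast, ← zpow_natCast, ← zpow_mul, ← zpow_mul, ← zpow_add, ← hgcd]; simp
    rw [this, hδr, one_zpow, one_mul]
    exact Γ.zpow_mem hpow _
  have hDΓ : ∀ u, D u ∈ Γ := by
    intro u
    have hDa' : D a ∈ Γ := by simpa using Γ.mul_mem (Γ.inv_mem hδΓ) hδD
    obtain ⟨n, rfl⟩ := ha u
    simpa using Γ.zpow_mem hDa' n
  have hS : ∀ t : K, (1, permuteArguments K (ZMod r) (Equiv.addRight t)) ∈ Γ := by
    intro t
    by_cases ht : t = 0
    · subst ht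
      have : Equiv.addRight (0 : K) = 1 := by ext; simp
      rw [this, map_one]; exact Γ.one_mem
    · have := Γ.mul_mem (Γ.mul_mem (hDΓ (Units.mk0 t ht)) h₁) (Γ.inv_mem (hDΓ (Units.mk0 t ht)))
      rw [hDa] at this
      simp only [Prod.mk_mul_mk, Prod.inv_mk, mul_one, mul_inv_cancel, ← map_mul, ← map_inv] at this
      convert this using 4
      ext y
      simp [Perm.mul_apply, mul_add, ht]
  have hsingle : ∀ w : K, (1, translateBy K (ZMod r) (.ofAdd (Pi.single w 1))) ∈ Γ := by
    intro w
    have := Γ.mul_mem (Γ.mul_mem (hS w) hδΓ) (Γ.inv_mem (hS w))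
    simp only [hδ, Prod.mk_mul_mk, Prod.inv_mk, mul_one, inv_one,
      permuteArguments_mul_translateBy, permuteArguments_single, mul_inv_cancel_right] at this
    simpa using this
  have hT : ∀ c : K → ZMod r, (1, translateBy K (ZMod r) (.ofAdd c)) ∈ Γ := by
    let M : AddSubgroup (K → ZMod r) :=
      (Γ.comap ((MonoidHom.inr Kˣ (Perm (K → ZMod r))).comp (translateBy K (ZMod r)))).toAddSubgroup'
    intro c
    have : Fintype K := Fintype.ofFinite K
    change c ∈ M
    rw [← Finset.univ_sum_single c]
    refine M.sum_mem fun w _ => ?_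
    have hw : (Pi.single w 1 : K → ZMod r) ∈ M := hsingle w
    have : Pi.single w (c w) = (c w).cast (R := ℤ) • (Pi.single w 1 : K → ZMod r) := by
      rw [← Pi.single_smul]; simp
    rw [this]
    exact M.zsmul_mem hw _
  rintro ⟨u, π⟩ h
  obtain ⟨t, c, rfl⟩ := exists_eq_of_mem_affineWreath h
  simpa [hDa] using Γ.mul_mem (Γ.mul_mem (hS t) (hDΓ u)) (hT c)

theorem range_lift_eq_affineWreath {F : Type*} [Group F] (b : FreeGroupBasis (Fin 2) F) {a : Kˣ}
    (ha : ∀ u : Kˣ, u ∈ Subgroup.zpowers a) (hr : r.Coprime (Nat.card Kˣ)) :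
    (b.lift ![(1, permuteArguments K (ZMod r) (Equiv.addRight 1)),
      (a, translateBy K _ (.ofAdd (Pi.single 0 1)) *
        permuteArguments K _ (Units.mulLeft a))]).range = affineWreath K (ZMod r) := by
  set Θ := b.lift ![((1 : Kˣ), permuteArguments K (ZMod r) (Equiv.addRight 1)),
      (a, translateBy K _ (.ofAdd (Pi.single 0 1)) *
        permuteArguments K _ (Units.mulLeft a))] with hΘ
  have h0 : Θ (b 0) = (1, permuteArguments K (ZMod r) (Equiv.addRight 1)) := by simp [hΘ]
  have h1 : Θ (b 1) = (a, translateBy K _ (.ofAdd (Pi.single 0 1)) *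
        permuteArguments K _ (Units.mulLeft a)) := by simp [hΘ]
  apply le_antisymm
  · have hmem : ∀ i, Θ (b i) ∈ affineWreath K (ZMod r) := by
      intro i
      fin_cases i
      · simp only [Fin.zero_eta, h0]; exact permute_addRight_mem_affineWreath 1
      · simp only [Fin.mk_one, h1]
        simpa using mul_mem (translateBy_mem_affineWreath (Pi.single 0 1 : K → ZMod r))
          (permute_mulLeft_mem_affineWreath a)
    -- `Θ` agrees on the basis with a homomorphism that factors through `affineWreath`
    have : Θ = (affineWreath K (ZMod r)).subtype.comp
        (b.lift fun i => (⟨Θ (b i), hmem i⟩ : affineWreath K (ZMod r))) :=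
      b.ext_hom _ _ fun i => by simp
    rw [this]
    rintro _ ⟨g, rfl⟩
    exact SetLike.coe_mem _
  · exact affineWreath_le_of_generators ha hr ⟨b 0, h0⟩ ⟨b 1, h1⟩

end Generators

/-! ### Indices along edges of the graph -/

section LocalCommensurability

open Equiv (Perm)

variable {G : Type*} [Group G]

/-- The orbit-stabilizer theorem for a subgroup `H` acting through `φ`. -/
theorem relIndex_comap_stabilizer {X : Type*} (φ : G →* Perm X) (H : Subgroup G) (x : X) :
    ((MulAction.stabilizer (Perm X) x).comap φ).relIndex H =
      ((fun g => φ g x) '' (H : Set G)).ncard := by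
  let _ : MulAction H X := MulAction.compHom X (φ.comp H.subtype)
  have h1 : ((MulAction.stabilizer (Perm X) x).comap φ).subgroupOf H =
      MulAction.stabilizer H x := by ext; rfl
  have h2 : (fun g => φ g x) '' (H : Set G) = MulAction.orbit H x := by
    ext y
    constructor
    · rintro ⟨g, hg, rfl⟩
      exact ⟨⟨g, hg⟩, rfl⟩
    · rintro ⟨g, rfl⟩
      exact ⟨g, g.2, rfl⟩
  rw [Subgroup.relIndex, h1, h2, MulAction.index_stabilizer]

variable {p : ℕ}

theorem exists_relIndex_eq_pow_of_adj (hp : p.Prime) {A B : {H : Subgroup G // H.FiniteIndex}}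
    (h : (localCommGraph p G).Adj A B) :
    (∃ i, (A.1 ⊓ B.1).relIndex A.1 = p ^ i) ∧ ∃ j, (A.1 ⊓ B.1).relIndex B.1 = p ^ j := by
  obtain ⟨-, k, hk⟩ := h
  obtain ⟨i, -, hi⟩ := (Nat.dvd_prime_pow hp).1 (Dvd.intro _ hk)
  obtain ⟨j, -, hj⟩ := (Nat.dvd_prime_pow hp).1 (Dvd.intro_left _ hk)
  exact ⟨⟨i, hi⟩, j, hj⟩

/-- Indices in one component agree up to powers of `p`, as this holds along every edge. -/
theorem exists_index_mul_pow_eq_of_reachable (hp : p.Prime)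
    {A B : {H : Subgroup G // H.FiniteIndex}} (h : (localCommGraph p G).Reachable A B) :
    ∃ i j, A.1.index * p ^ i = B.1.index * p ^ j := by
  obtain ⟨w⟩ := h
  induction w with
  | nil => exact ⟨0, 0, rfl⟩
  | cons hadj _ ih =>
    obtain ⟨⟨i, hi⟩, j, hj⟩ := exists_relIndex_eq_pow_of_adj hp hadj
    obtain ⟨k, l, hkl⟩ := ih
    refine ⟨i + k, l + j, ?_⟩
    rw [pow_add, pow_add, ← mul_assoc, ← mul_assoc, ← hkl, ← hi, ← hj,
      mul_comm _ (Subgroup.relIndex _ _), Subgroup.relIndex_mul_index inf_le_left,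
      mul_right_comm, mul_comm _ (Subgroup.relIndex _ _), Subgroup.relIndex_mul_index inf_le_right]

theorem index_eq_of_reachable (hp : p.Prime) {A B : {H : Subgroup G // H.FiniteIndex}}
    (h : (localCommGraph p G).Reachable A B) (hA : A.1.index.Coprime p) (hB : B.1.index.Coprime p) :
    A.1.index = B.1.index := by
  obtain ⟨i, j, hij⟩ := exists_index_mul_pow_eq_of_reachable hp h
  exact Nat.dvd_antisymm ((hA.pow_right j).dvd_of_dvd_mul_right (Dvd.intro _ hij))
    ((hB.pow_right i).dvd_of_dvd_mul_right (Dvd.intro _ hij.symm))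

/-- A homomorphism to a group of order prime to `p` that is onto on `H` stays onto on subgroups of
`p`-power index: the index of the image is a divisor both of a power of `p` and of `|C|`. -/
theorem map_eq_top_of_relIndex_eq_pow {C : Type*} [Group C] (χ : G →* C)
    (hC : p.Coprime (Nat.card C)) {J H : Subgroup G} (hJH : J ≤ H) {k : ℕ}
    (hJ : J.relIndex H = p ^ k) (hH : H.map χ = ⊤) : J.map χ = ⊤ := by
  have hsurj : Function.Surjective (χ.comp H.subtype) := by
    rw [← MonoidHom.range_eq_top, MonoidHom.range_comp, Subgroup.range_subtype, hH]
  have hmap : (J.subgroupOf H).map (χ.comp H.subtype) = J.map χ := by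
    rw [← Subgroup.map_map, Subgroup.map_subgroupOf_eq_of_le hJH]
  rw [← Subgroup.index_eq_one]
  refine Nat.eq_one_of_dvd_coprimes (hC.pow_left k) ?_ (Subgroup.index_dvd_card _)
  rw [← hJ, ← hmap]
  exact Subgroup.index_map_dvd _ hsurj

end LocalCommensurability

/-! ### Fixed functions of subgroups along a walk -/

section FixedFunctions

theorem exists_ncard_ne_le_of_sub_eq_const {K : Type*} [Finite K] {r : ℕ} {v v' : K → ZMod r} {n : ℕ}
    (hv : ∃ c, {y | v y ≠ c}.ncard ≤ n) (h : ∃ (w : K) (c : ZMod r), ∀ y ≠ w, v' y = v y + c) :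
    ∃ c, {y | v' y ≠ c}.ncard ≤ n + 1 := by
  obtain ⟨c, hc⟩ := hv
  obtain ⟨w, d, hd⟩ := h
  refine ⟨c + d, ?_⟩
  refine (Set.ncard_le_ncard (t := insert w {y | v y ≠ c}) ?_ (Set.toFinite _)).trans
    ((Set.ncard_insert_le _ _).trans (by omega))
  intro y hy
  by_cases hyw : y = w
  · exact Or.inl hyw
  · refine Or.inr fun hvy => hy ?_
    rw [hd y hyw, hvy]

open Equiv (Perm)

variable {G : Type*} [Group G] {K : Type*} [Field K] {p r : ℕ}

/-- The stabilizer of `v` under the action of `G` through the second coordinate of `Θ`. -/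
def functionStabilizer {V : Type*} (Θ : G →* Kˣ × Perm V) (v : V) : Subgroup G :=
  (MulAction.stabilizer (Perm V) v).comap ((MonoidHom.snd _ _).comp Θ)

theorem mem_functionStabilizer {V : Type*} {Θ : G →* Kˣ × Perm V} {v : V} {g : G} :
    g ∈ functionStabilizer Θ v ↔ (Θ g).2 v = v := Iff.rfl

variable [Finite K]

instance [NeZero r] (Θ : G →* Kˣ × Perm (K → ZMod r)) (v : K → ZMod r) :
    (functionStabilizer Θ v).FiniteIndex := by
  refine ⟨?_⟩
  rw [functionStabilizer, Subgroup.index_comap]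
  exact Subgroup.FiniteIndex.index_ne_zero

/-- If a subgroup of `p`-power index in `H` fixes a function, then `H` fixes some function too:
the `H`-orbit of the first function has `p`-power length, which is invertible modulo `r`, and `H` acts by affine maps, so it
fixes the average of the orbit. -/
theorem exists_le_functionStabilizer [NeZero r] {Θ : G →* Kˣ × Perm (K → ZMod r)}
    (hΘ : Θ.range ≤ affineWreath K (ZMod r)) (hp : p.Prime) (hpr : p.Coprime r) {J H : Subgroup G}
    {k : ℕ} (hJ : J.relIndex H = p ^ k) {v : K → ZMod r} (hv : J ≤ functionStabilizer Θ v) :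
    ∃ v', H ≤ functionStabilizer Θ v' := by
  classical
  set O : Set (K → ZMod r) := (fun g => (Θ g).2 v) '' (H : Set G) with hO
  obtain ⟨i, -, hi⟩ : ∃ i ≤ k, O.ncard = p ^ i := by
    rw [← Nat.dvd_prime_pow hp, ← hJ]
    have := relIndex_comap_stabilizer ((MonoidHom.snd _ _).comp Θ) H v
    exact this ▸ Subgroup.relIndex_dvd_of_le_left _ hv
  have hunit : (O.ncard : ZMod r) * (O.ncard : ZMod r)⁻¹ = 1 :=
    ZMod.coe_mul_inv_eq_one _ (hi ▸ hpr.pow_left i)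
  have : Fintype O := Fintype.ofFinite O
  refine ⟨fun y => (O.ncard : ZMod r)⁻¹ * ∑ o : O, o.1 y, fun h hh => ?_⟩
  obtain ⟨t, c, hc⟩ := hΘ ⟨h, rfl⟩
  rw [mem_functionStabilizer]
  ext z
  obtain ⟨y, rfl⟩ : ∃ y, ((Θ h).1 : K) * y + t = z := ⟨((Θ h).1⁻¹ : Kˣ) * (z - t), by simp⟩
  -- `h` permutes `O`
  have hmaps : Set.MapsTo (Θ h).2 O O := by
    rintro _ ⟨g, hg, rfl⟩
    exact ⟨h * g, H.mul_mem hh hg, by simp⟩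
  have hbij : Function.Bijective (hmaps.restrict (Θ h).2 O O) :=
    Finite.injective_iff_bijective.1 ((Set.MapsTo.restrict_inj hmaps).2 (Θ h).2.injective.injOn)
  rw [hc, ← hbij.sum_comp (fun o : O => o.1 ((Θ h).1 * y + t))]
  simp only [Set.MapsTo.val_restrict_apply, hc, Finset.sum_add_distrib, Finset.sum_const, mul_add,
    Finset.card_univ, nsmul_eq_mul, ← Nat.card_eq_fintype_card, Nat.card_coe_set_eq]
  rw [← mul_assoc, mul_comm _ (O.ncard : ZMod r), hunit, one_mul]

/-- Two functions fixed by a subgroup `J` whose multipliers exhaust `Kˣ` differ by a constant, except at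
one point. Indeed `J` contains an element whose multiplier generates `Kˣ`; its affine map fixes one point
of `K` and permutes the others cyclically, and it preserves the difference of the two functions. -/
theorem exists_sub_eq_const {Θ : G →* Kˣ × Perm (K → ZMod r)}
    (hΘ : Θ.range ≤ affineWreath K (ZMod r)) (hK : 3 ≤ Nat.card K) {J : Subgroup G}
    (hJ : J.map ((MonoidHom.fst _ _).comp Θ) = ⊤) {v v' : K → ZMod r}
    (hv : J ≤ functionStabilizer Θ v) (hv' : J ≤ functionStabilizer Θ v') :
    ∃ (w : K) (c : ZMod r), ∀ y ≠ w, v' y = v y + c := by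
  obtain ⟨a, ha⟩ := IsCyclic.exists_generator (α := Kˣ)
  have ha1 : (a : K) ≠ 1 := by
    intro h
    obtain rfl : a = 1 := Units.ext h
    have : Subsingleton Kˣ := ⟨fun x y => by
      obtain ⟨m, rfl⟩ := ha x
      obtain ⟨n, rfl⟩ := ha y
      simp⟩
    have := Finite.card_le_one_iff_subsingleton.2 this
    rw [Nat.card_units] at this
    omega
  obtain ⟨g, hg, hga⟩ : a ∈ J.map ((MonoidHom.fst _ _).comp Θ) := hJ ▸ Subgroup.mem_top a
  obtain ⟨t, c, hc⟩ := hΘ ⟨g, rfl⟩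
  have hga : (Θ g).1 = a := hga
  rw [hga] at hc
  have h1 : ∀ y, v (a * y + t) = v y + c y := fun y => by
    rw [← hc, mem_functionStabilizer.1 (hv hg)]
  have h2 : ∀ y, v' (a * y + t) = v' y + c y := fun y => by
    rw [← hc, mem_functionStabilizer.1 (hv' hg)]
  have hinv : ∀ y, v' (a * y + t) - v (a * y + t) = v' y - v y := fun y => by
    rw [h1, h2]; ring
  -- the affine map `y ↦ a * y + t` has the fixed point `w` and permutes its complement cyclically
  have hne : 1 - (a : K) ≠ 0 := sub_ne_zero.2 ha1.symm
  set w : K := t / (1 - a) with hw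
  have hw' : a * w + t = w := by rw [hw]; field_simp; ring
  have horbit : ∀ (n : ℕ) (x : K),
      v' (w + a ^ n * x) - v (w + a ^ n * x) = v' (w + x) - v (w + x) := by
    intro n x
    induction n with
    | zero => simp
    | succ n ih =>
      rw [← ih, ← hinv (w + a ^ n * x)]
      have : w + a ^ (n + 1) * x = a * (w + a ^ n * x) + t := by
        linear_combination -hw'
      rw [this]
  refine ⟨w, v' (w + 1) - v (w + 1), fun y hy => ?_⟩
  obtain ⟨n, hn⟩ := (Submonoid.mem_powers_iff _ _).1
    (mem_powers_iff_mem_zpowers.2 (ha (Units.mk0 (y - w) (sub_ne_zero.2 hy))))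
  have hn' : (a : K) ^ n = y - w := by simpa using congrArg Units.val hn
  have := horbit n 1
  rw [hn', mul_one, add_sub_cancel] at this
  rw [← this]; ring

/-- If the start of a walk has all multipliers and fixes a function that is constant off `n` points,
then its end has all multipliers and fixes a function that is constant off `n + γ.length` points. -/
theorem exists_fixed_of_walk [NeZero r] {Θ : G →* Kˣ × Perm (K → ZMod r)}
    (hΘ : Θ.range ≤ affineWreath K (ZMod r)) (hK : 3 ≤ Nat.card K) (hp : p.Prime)
    (hpr : p.Coprime r) (hpK : p.Coprime (Nat.card Kˣ)) {A B : {H : Subgroup G // H.FiniteIndex}}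
    (γ : (localCommGraph p G).Walk A B) {v : K → ZMod r} {n : ℕ}
    (hA : A.1.map ((MonoidHom.fst _ _).comp Θ) = ⊤) (hv : A.1 ≤ functionStabilizer Θ v)
    (hn : ∃ c, {y | v y ≠ c}.ncard ≤ n) :
    B.1.map ((MonoidHom.fst _ _).comp Θ) = ⊤ ∧ ∃ v', B.1 ≤ functionStabilizer Θ v' ∧
      ∃ c, {y | v' y ≠ c}.ncard ≤ n + γ.length := by
  induction γ generalizing v n with
  | nil => exact ⟨hA, v, hv, hn⟩
  | cons hadj γ ih =>
    obtain ⟨⟨i, hi⟩, j, hj⟩ := exists_relIndex_eq_pow_of_adj hp hadj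
    have hJ := map_eq_top_of_relIndex_eq_pow _ hpK inf_le_left hi hA
    obtain ⟨v₁, hv₁⟩ := exists_le_functionStabilizer hΘ hp hpr hj (inf_le_left.trans hv)
    have hn₁ := exists_ncard_ne_le_of_sub_eq_const hn (exists_sub_eq_const hΘ hK hJ
      (inf_le_left.trans hv) (inf_le_right.trans hv₁))
    have := ih (top_le_iff.1 (hJ ▸ Subgroup.map_mono inf_le_right)) hv₁ hn₁
    rwa [SimpleGraph.Walk.length_cons, add_comm γ.length, ← add_assoc]

end FixedFunctions

/-! ### Stabilizers of functions as vertices -/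

section Paths

open Equiv (Perm)

variable {G : Type*} [Group G] {K : Type*} [Field K] {p r : ℕ}
  {Θ : G →* Kˣ × Perm (K → ZMod r)}

/-- The stabilizer of `v` moves `v + Pi.single w c` exactly to the functions `v + Pi.single w' c`. -/
theorem relIndex_functionStabilizer_add_single [DecidableEq K]
    (hΘ : Θ.range = affineWreath K (ZMod r)) (v : K → ZMod r) (w : K) {c : ZMod r} (hc : c ≠ 0) :
    (functionStabilizer Θ (v + Pi.single w c)).relIndex (functionStabilizer Θ v) = Nat.card K := by
  refine (relIndex_comap_stabilizer ((MonoidHom.snd _ _).comp Θ) _ _).trans ?_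
  have himage : (fun g => (Θ g).2 (v + Pi.single w c)) '' (functionStabilizer Θ v : Set G) =
      Set.range fun w' : K => v + Pi.single w' c := by
    ext f
    constructor
    · rintro ⟨g, hg, rfl⟩
      obtain ⟨t, d, hd⟩ := hΘ.le ⟨g, rfl⟩
      refine ⟨(Θ g).1 * w + t, ?_⟩
      ext z
      obtain ⟨y, rfl⟩ : ∃ y, ((Θ g).1 : K) * y + t = z :=
        ⟨((Θ g).1⁻¹ : Kˣ) * (z - t), by simp⟩
      have hv := hd v y
      rw [mem_functionStabilizer.1 hg] at hv
      simp only [hd, Pi.add_apply, hv]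
      simp [Pi.single_apply]
      ring
    · rintro ⟨w', rfl⟩
      obtain ⟨g, hg⟩ := hΘ.ge (mul_mem (mul_mem (translateBy_mem_affineWreath v)
        (permute_addRight_mem_affineWreath (w' - w))) (translateBy_mem_affineWreath (-v)))
      have hg' : ∀ f, (Θ g).2 f =
          v + permuteArguments K _ (Equiv.addRight (w' - w)) (-v + f) := fun f => by
        rw [hg]; rfl
      refine ⟨g, ?_, ?_⟩
      · have h0 := permuteArguments_single (Equiv.addRight (w' - w)) w (0 : ZMod r)
        rw [Pi.single_zero, Pi.single_zero] at h0
        rw [SetLike.mem_coe, mem_functionStabilizer, hg', neg_add_cancel, h0, add_zero]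
      · simp only [hg', neg_add_cancel_left, permuteArguments_single]
        simp
  refine (congrArg Set.ncard himage).trans ?_
  rw [← Nat.card_coe_set_eq, Nat.card_range_of_injective]
  intro x y hxy
  by_contra hne
  have := congrFun (add_left_cancel hxy) x
  simp [hne] at this
  exact hc this

theorem index_functionStabilizer [Finite K] (hΘ : Θ.range = affineWreath K (ZMod r)) (v : K → ZMod r) :
    (functionStabilizer Θ v).index = r ^ Nat.card K := by
  rw [← Subgroup.relIndex_top_right]
  refine (relIndex_comap_stabilizer ((MonoidHom.snd _ _).comp Θ) _ _).trans ?_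
  have himage : (fun g => (Θ g).2 v) '' ((⊤ : Subgroup G) : Set G) = Set.univ := by
    refine Set.eq_univ_of_forall fun f => ?_
    obtain ⟨g, hg⟩ := hΘ.ge (translateBy_mem_affineWreath (f - v))
    refine ⟨g, trivial, ?_⟩
    exact (congrArg (fun q => q.2 v) hg).trans (sub_add_cancel f v)
  refine (congrArg Set.ncard himage).trans ?_
  rw [Set.ncard_univ, Nat.card_fun, Nat.card_zmod]

theorem map_functionStabilizer_zero (hΘ : Θ.range = affineWreath K (ZMod r)) :
    (functionStabilizer Θ 0).map ((MonoidHom.fst _ _).comp Θ) = ⊤ := by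
  refine top_le_iff.1 fun u _ => ?_
  obtain ⟨g, hg⟩ := hΘ.ge (permute_mulLeft_mem_affineWreath u)
  refine ⟨g, ?_, ?_⟩
  · rw [SetLike.mem_coe, mem_functionStabilizer, hg]
    rfl
  · simp [hg]

variable [Finite K] [NeZero r]

/-- The stabilizer of `v`, as a vertex of the local commensurability graph. -/
abbrev functionVertex (Θ : G →* Kˣ × Perm (K → ZMod r)) (v : K → ZMod r) :
    {H : Subgroup G // H.FiniteIndex} :=
  ⟨functionStabilizer Θ v, inferInstance⟩

theorem reachable_functionVertex_add_single [DecidableEq K]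
    (hΘ : Θ.range = affineWreath K (ZMod r)) {d : ℕ} (hK : Nat.card K = p ^ d)
    (v : K → ZMod r) (w : K) (c : ZMod r) :
    (localCommGraph p G).Reachable (functionVertex Θ v) (functionVertex Θ (v + Pi.single w c)) := by
  by_cases hne : functionVertex Θ v = functionVertex Θ (v + Pi.single w c)
  · rw [← hne]
  · have hc : c ≠ 0 := by
      rintro rfl
      simp at hne
    have h1 := relIndex_functionStabilizer_add_single hΘ v w hc
    have h2 := relIndex_functionStabilizer_add_single hΘ (v + Pi.single w c) w (neg_ne_zero.2 hc)
    rw [add_assoc, ← Pi.single_add, add_neg_cancel, Pi.single_zero, add_zero] at h2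
    refine SimpleGraph.Adj.reachable ⟨hne, d + d, ?_⟩
    rw [Subgroup.inf_relIndex_left, Subgroup.inf_relIndex_right, h1, h2, hK, pow_add]

theorem reachable_functionVertex (hΘ : Θ.range = affineWreath K (ZMod r)) {d : ℕ}
    (hK : Nat.card K = p ^ d) (v : K → ZMod r) :
    (localCommGraph p G).Reachable (functionVertex Θ 0) (functionVertex Θ v) := by
  classical
  have := Fintype.ofFinite K
  rw [← Finset.univ_sum_single v]
  induction (Finset.univ : Finset K) using Finset.induction_on with
  | empty => simp
  | insert w s hw ih =>
    rw [Finset.sum_insert hw, add_comm]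
    exact ih.trans (reachable_functionVertex_add_single hΘ hK _ w _)

/-- A function fixed by the stabilizer of the indicator function of `S` differs from this indicator
function by a constant outside one point, so it is far from constant if `S` and its complement are large. -/
theorem lt_length_of_walk_to_indicator (hΘ : Θ.range = affineWreath K (ZMod r))
    (hK : 3 ≤ Nat.card K) (hp : p.Prime) (hpr : p.Coprime r) (hpK : p.Coprime (Nat.card Kˣ))
    (hr : 1 < r) {N : ℕ} {S : Set K} (hS : N + 2 ≤ S.ncard) (hS' : N + 2 ≤ Sᶜ.ncard)
    (γ : (localCommGraph p G).Walk (functionVertex Θ 0) (functionVertex Θ (S.indicator 1))) :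
    N < γ.length := by
  have : Fact (1 < r) := ⟨hr⟩
  obtain ⟨htop, v, hv, hn⟩ := exists_fixed_of_walk hΘ.le hK hp hpr hpK γ (n := 0)
    (map_functionStabilizer_zero hΘ) le_rfl ⟨0, by simp⟩
  obtain ⟨c, hc⟩ := exists_ncard_ne_le_of_sub_eq_const hn
    (exists_sub_eq_const hΘ.le hK htop hv le_rfl)
  by_cases h1 : c = 1
  · have : Sᶜ.ncard ≤ _ := Set.ncard_le_ncard (t := {y | S.indicator 1 y ≠ c})
      (fun y hy => by simp [Set.indicator_of_notMem hy, h1]) (Set.toFinite _)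
    omega
  · have : S.ncard ≤ _ := Set.ncard_le_ncard (t := {y | S.indicator 1 y ≠ c})
      (fun y hy => by simpa [Set.indicator_of_mem hy] using Ne.symm h1) (Set.toFinite _)
    omega

end Paths

theorem theorem2 {F : Type*} [Group F] (b : FreeGroupBasis (Fin 2) F)
    (p : ℕ) (hp : p.Prime) (N : ℕ) :
    ∃ (A B : ℕ → {H : Subgroup F // H.FiniteIndex})
      (γ : ∀ n, (localCommGraph p F).Walk (A n) (B n)),
      Function.Injective (fun n => (localCommGraph p F).connectedComponentMk (A n)) ∧
      ∀ n, (γ n).IsGeodesic ∧ N < (γ n).length := by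
  classical
  have : Fact p.Prime := ⟨hp⟩
  -- large enough that `K` splits into two sets of at least `N + 2` elements
  let d := 2 * N + 4
  let K := GaloisField p d
  have hd : d ≠ 0 := by omega
  have hK : Nat.card K = p ^ d := GaloisField.card p d hd
  have hKd : d < Nat.card K := hK ▸ Nat.lt_pow_self hp.one_lt
  have hKunits : Nat.card Kˣ = p ^ d - 1 := by rw [Nat.card_units, hK]
  have hpK : p.Coprime (Nat.card Kˣ) := by
    rw [hKunits, Nat.coprime_comm]
    refine Nat.Coprime.coprime_dvd_right (dvd_pow_self p hd) ?_
    exact (Nat.coprime_self_sub_left (Nat.one_le_pow _ _ hp.pos)).2 (Nat.coprime_one_left _)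
  obtain ⟨S, -, hS⟩ := Set.exists_subset_card_eq (s := (Set.univ : Set K)) (n := N + 2)
    (by rw [Set.ncard_univ]; omega)
  have hS' : N + 2 ≤ Sᶜ.ncard := by
    have := Set.ncard_add_ncard_compl S
    omega
  obtain ⟨a, ha⟩ := IsCyclic.exists_generator (α := Kˣ)
  -- infinitely many moduli prime to `p` and to `|Kˣ|`
  let r : ℕ → ℕ := fun n => (n + 1) * (p * Nat.card Kˣ) + 1
  have hpos : 0 < p * Nat.card Kˣ := Nat.mul_pos hp.pos Nat.card_pos
  have hr1 : ∀ n, 1 < r n := fun n => Nat.lt_add_of_pos_left (Nat.mul_pos n.succ_pos hpos)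
  have hrinj : Function.Injective r := fun m n h => by
    simpa [r, hpos.ne', hp.ne_zero] using h
  have hrcop : ∀ n, (r n).Coprime (p * Nat.card Kˣ) := fun n => by
    simp [r, Nat.coprime_mul_right_add_left]
  have hrp : ∀ n, (r n).Coprime p := fun n => (hrcop n).coprime_mul_right_right
  have : ∀ n, NeZero (r n) := fun n => ⟨by simp [r]⟩
  let Θ : ∀ n, F →* Kˣ × Equiv.Perm (K → ZMod (r n)) := fun n =>
    b.lift ![(1, permuteArguments K _ (Equiv.addRight 1)),
      (a, translateBy K _ (.ofAdd (Pi.single 0 1)) * permuteArguments K _ (Units.mulLeft a))]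
  have hΘ : ∀ n, (Θ n).range = affineWreath K (ZMod (r n)) := fun n =>
    range_lift_eq_affineWreath b ha (hrcop n).coprime_mul_left_right
  have hgeod := fun n =>
    (reachable_functionVertex (hΘ n) hK (S.indicator 1)).exists_walk_length_eq_dist
  choose γ hγ using hgeod
  refine ⟨_, _, γ, fun m n hmn => ?_, fun n => ⟨hγ n, ?_⟩⟩
  · have hidx := index_eq_of_reachable hp (SimpleGraph.ConnectedComponent.exact hmn)
      (by rw [index_functionStabilizer (hΘ m)]; exact (hrp m).pow_left _)
      (by rw [index_functionStabilizer (hΘ n)]; exact (hrp n).pow_left _)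
    rw [index_functionStabilizer (hΘ m), index_functionStabilizer (hΘ n)] at hidx
    exact hrinj (Nat.pow_left_injective Nat.card_pos.ne' hidx)
  · exact lt_length_of_walk_to_indicator (hΘ n) (by omega) hp (hrp n).symm hpK (hr1 n) hS.ge hS'
      (γ n)
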